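/- An antimatroid is a finite family $\mathcal{A}$ of finite sets that is accessible (for every nonempty $S\in\mathcal{A}$ there is $x\in S$ with $S\setminus\{x\}\in\mathcal{A}$) and closed under unions; its elements are the members of $\bigcup\mathcal{A}$. A path of $\mathcal{A}$ is a set $P\in\mathcal{A}$ for which there is exactly one $x\in P$ with $P\setminus\{x\}\in\mathcal{A}$. The height of $\mathcal{A}$ is the height of its path poset, i.e. the largest number of paths in a chain of paths ordered by inclusion. A basic word of $\mathcal{A}$ is a permutation of its elements such that the set of elements of every prefix belongs to $\mathcal{A}$. For elements $x,y$, let $\Pr[x<y]$ be the probability that $x$ occurs earlier than $y$ in a basic word chosen uniformly at random among all basic words; the pair $x,y$ is balanced if $\min\{\Pr[x<y],\Pr[y<x]\}\ge\frac13$. **Theorem.** Let $\mathcal{A}$ be an antimatroid with at least one element and with height at most two. Then either $\mathcal{A}$ has one or two elements and defines a total order on its elements (that is, $\mathcal{A}$ has exactly one basic word), or $\mathcal{A}$ contains a balanced pair. -/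

import Mathlib

/-- An antimatroid: a finite family of finite sets that is accessible and closed under unions. -/
structure Antimatroid (α : Type*) [DecidableEq α] where
  /-- The members of the family. -/
  sets : Finset (Finset α)
  /-- Every nonempty member contains an element whose removal leaves a member. -/
  accessible : ∀ S ∈ sets, S.Nonempty → ∃ x ∈ S, S.erase x ∈ sets
  /-- The family is closed under unions. -/
  union_mem : ∀ S ∈ sets, ∀ T ∈ sets, S ∪ T ∈ sets

namespace Antimatroid

variable {α : Type*} [DecidableEq α]

/-- The elements of an antimatroid: the union of all its members. -/
def elements (A : Antimatroid α) : Finset α := A.sets.biUnion id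

/-- A path is a member `P` that has exactly one element `x` (its endpoint) for which
`P \ {x}` is a member. -/
def IsPath (A : Antimatroid α) (P : Finset α) : Prop :=
  P ∈ A.sets ∧ ∃! x, x ∈ P ∧ P.erase x ∈ A.sets

/-- The height of an antimatroid: the height of its path poset, that is, the largest number of
paths in a chain of paths ordered by inclusion. -/
noncomputable def height (A : Antimatroid α) : ℕ∞ :=
  Set.chainHeight {P : Finset α | A.IsPath P} (fun P Q => P ⊆ Q)

/-- The basic words: the permutations of the elements (listings of every element exactly once)
such that the set of elements of every prefix is a member of the antimatroid. -/
def basicWords (A : Antimatroid α) : Finset (List α) :=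
  (⟨A.elements.val.lists, Multiset.lists_nodup_finset A.elements⟩ : Finset (List α)).filter
    (fun w => ∀ u ∈ w.inits, u.toFinset ∈ A.sets)

theorem mem_basicWords (A : Antimatroid α) (w : List α) :
    w ∈ A.basicWords ↔
      w.Nodup ∧ w.toFinset = A.elements ∧ ∀ u, u <+: w → u.toFinset ∈ A.sets := by
  have key : A.elements.val = (w : Multiset α) ↔ w.Nodup ∧ w.toFinset = A.elements := by
    constructor
    · intro h
      have hn : w.Nodup := by
        have := A.elements.nodup
        rw [h] at this
        exact Multiset.coe_nodup.1 this
      refine ⟨hn, ?_⟩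
      apply Finset.val_injective
      rw [h, List.toFinset_val, hn.dedup]
    · rintro ⟨hn, h⟩
      rw [← h, List.toFinset_val, hn.dedup]
  simp only [basicWords, Finset.mem_filter, Finset.mem_mk, Multiset.mem_lists_iff,
    Multiset.quot_mk_to_coe, List.mem_inits, key, and_assoc]

/-- `Pr[x < y]`: the probability that `x` occurs earlier than `y` in a basic word selected
uniformly at random among all basic words. -/
def prob (A : Antimatroid α) (x y : α) : ℚ :=
  ((A.basicWords.filter (fun w => w.idxOf x < w.idxOf y)).card : ℚ) / (A.basicWords.card : ℚ)

/-- A balanced pair: elements `x`, `y` with `min {Pr[x < y], Pr[y < x]} ≥ 1/3`. -/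
def IsBalancedPair (A : Antimatroid α) (x y : α) : Prop :=
  x ∈ A.elements ∧ y ∈ A.elements ∧ (1 / 3 : ℚ) ≤ min (A.prob x y) (A.prob y x)

/-- A chain antimatroid is an antimatroid with a single basic word; equivalently, it is the
antimatroid defined by a total order on its elements. -/
def IsChainAntimatroid (A : Antimatroid α) : Prop := ∃! w, w ∈ A.basicWords

end Antimatroid

/-!
The argument counts basic words. Let `S` be the set of elements that are members on their own and
`T` the set of the others. An element of `S` may be moved one place towards the front of any basic
word (`Antimatroid.exchange_of_singleton_mem`), because the new prefix is a union of members. In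
height at most two an element of `T` may be moved one place towards the back
(`Antimatroid.exchange_of_singleton_not_mem`): if it were needed for the next letter `b`, a path
ending in `b` would properly contain a path ending in the element, and this one a third path. So
either `S`, or `T` in the reversed words, is a set `X` of at least half of the letters which move
freely to the front. The counting argument for such a family of words is
`ForwardClosed.exists_balanced`.

Suppose that no two letters of `X` are balanced. The majority relation is a tournament, so `X` can
be listed as `a₁, …, aₘ` with each `aᵢ` before `aᵢ₊₁` in more than two thirds of the words
(`ForwardClosed.exists_isChain_numBefore`). The number of words with a letter of `X` at position `i`
decreases with `i`, and so does the number of words with `y ∈ X` at position `j` when the word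
without `y` has another letter `x` at a prescribed position. The second fact bounds the number of
words with `y` before `x` from below by the sum over all words of `ψ (position of x)` minus
`χ (position of y)`, for weights `ψ` and `χ` which satisfy finitely many linear inequalities. These
bounds are added over the consecutive pairs of the chain. What remains is a sum over the letters,
and it is estimated by the first fact, where only one letter can be the first of a word. With
suitable weights (`Certificate`) the result contradicts the assumption that each consecutive pair is
inverted in less than one third of the words (`ForwardClosed.exists_balanced_of_certificate`).

For `m` letters in words of length at most `2 m`, weights close to `√(i / n)` and `j / (2 n)`, where
`n = 2 m`, are suitable when `m ≥ 20`; for `4 ≤ m < 20` tables are checked by evaluation. The case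
`m = 3` needs the joint distribution of consecutive letters of the chain
(`ForwardClosed.exists_balanced_three_six`), and for `m = 2` words of length three are covered by
constant weights. When `S` and `T` have two elements each, the letters of `S` alone are not enough,
and if they are unbalanced, then the elements of `T` are balanced (`balanced_or_balanced_of_four`).
Finally, when `S` has one element and `T` at most one, there is a single basic word.
-/

/-! ### Exchanging two consecutive entries of a list -/

/-- The list obtained by exchanging the entries at positions `i` and `i + 1`; the list is left
alone when it has no position `i + 1`. -/
def List.exchangeAt {α : Type*} : ℕ → List α → List α
  | 0, a :: b :: l => b :: a :: l
  | i + 1, a :: l => a :: List.exchangeAt i l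
  | _, l => l

namespace List

theorem exchangeAt_append {α : Type*} (u v : List α) (a b : α) :
    (u ++ a :: b :: v).exchangeAt u.length = u ++ b :: a :: v := by
  induction u with
  | nil => rfl
  | cons c u ih => simpa [exchangeAt] using ih

theorem exists_eq_append_of_succ_lt_length {α : Type*} {w : List α} {i : ℕ}
    (h : i + 1 < w.length) :
    ∃ u a b v, w = u ++ a :: b :: v ∧ u.length = i := by
  refine ⟨w.take i, w[i], w[i + 1], w.drop (i + 2), ?_, by simp; omega⟩
  rw [List.getElem_cons_drop, List.getElem_cons_drop, List.take_append_drop]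

theorem exchangeAt_exchangeAt {α : Type*} {w : List α} {i : ℕ} (h : i + 1 < w.length) :
    (w.exchangeAt i).exchangeAt i = w := by
  obtain ⟨u, a, b, v, rfl, rfl⟩ := exists_eq_append_of_succ_lt_length h
  rw [exchangeAt_append, exchangeAt_append]

/-- The exchange of the entries at `i` and `i + 1` is injective on the words for which it makes
sense. -/
theorem injOn_exchangeAt {α : Type*} (i : ℕ) :
    Set.InjOn (exchangeAt (α := α) i) {w : List α | i + 1 < w.length} := by
  intro w hw w' hw' he
  rw [← exchangeAt_exchangeAt hw, ← exchangeAt_exchangeAt hw', he]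

theorem idxOf_exchangeAt {α : Type*} [DecidableEq α] {w : List α} {i : ℕ} (hw : w.Nodup)
    (h : i + 1 < w.length) (e : α) :
    (w.exchangeAt i).idxOf e = Equiv.swap i (i + 1) (w.idxOf e) := by
  obtain ⟨u, a, b, v, rfl, rfl⟩ := exists_eq_append_of_succ_lt_length h
  have hab : a ≠ b := by
    rintro rfl
    simp [List.nodup_append] at hw
  rw [exchangeAt_append]
  simp only [List.idxOf_append]
  split_ifs with he
  · have := List.idxOf_lt_length_iff.2 he
    rw [Equiv.swap_apply_of_ne_of_ne] <;> omega
  · by_cases hea : e = a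
    · subst hea
      rw [List.idxOf_cons_ne _ hab.symm]
      simp [Equiv.swap_apply_left, Nat.add_comm]
    · by_cases heb : e = b
      · subst heb
        rw [List.idxOf_cons_ne _ hab]
        simp [Nat.add_comm]
      · rw [List.idxOf_cons_ne _ (Ne.symm hea), List.idxOf_cons_ne _ (Ne.symm heb),
          List.idxOf_cons_ne _ (Ne.symm hea), List.idxOf_cons_ne _ (Ne.symm heb),
          Equiv.swap_apply_of_ne_of_ne] <;> omega

end List

/-! ### Families of words in which some letters move freely to the front -/

/-- A finite family of words without repetitions in which the letters of `X` occur in every word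
and may be moved one place towards the front without leaving the family. -/
structure ForwardClosed {α : Type*} [DecidableEq α] (F : Finset (List α)) (X : Finset α) :
    Prop where
  nodup : ∀ w ∈ F, w.Nodup
  mem : ∀ w ∈ F, ∀ x ∈ X, x ∈ w
  exchange : ∀ w ∈ F, ∀ x ∈ X, ∀ i, w.idxOf x = i + 1 → w.exchangeAt i ∈ F

/-- The number of words of `F` with `x` before `y`. -/
def numBefore {α : Type*} [DecidableEq α] (F : Finset (List α)) (x y : α) : ℕ :=
  (F.filter fun w => w.idxOf x < w.idxOf y).card

/-- The number of words of `F` with `x` at position `i`. -/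
def numAt {α : Type*} [DecidableEq α] (F : Finset (List α)) (x : α) (i : ℕ) : ℕ :=
  (F.filter fun w => w.idxOf x = i).card

/-- The position of `x` in the word that remains of `w` when `y` is deleted. -/
def posWithout {α : Type*} [DecidableEq α] (x y : α) (w : List α) : ℕ :=
  if w.idxOf y < w.idxOf x then w.idxOf x - 1 else w.idxOf x

/-- The number of words of `F` with `y` at position `j` in which `x` is at position `r` once `y`
is deleted. -/
def numFibre {α : Type*} [DecidableEq α] (F : Finset (List α)) (x y : α) (r j : ℕ) : ℕ :=
  (F.filter fun w => posWithout x y w = r ∧ w.idxOf y = j).card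

namespace ForwardClosed

variable {α : Type*} [DecidableEq α] {F : Finset (List α)} {X : Finset α}

theorem numBefore_add_numBefore (h : ForwardClosed F X) {x y : α} (hx : x ∈ X)
    (hxy : x ≠ y) : numBefore F x y + numBefore F y x = F.card := by
  unfold numBefore
  rw [← Finset.card_filter_add_card_filter_not (s := F) fun w => w.idxOf x < w.idxOf y]
  congr 2
  apply Finset.filter_congr
  intro w hw
  have := (List.idxOf_inj (y := y) (h.mem w hw x hx)).not.2 hxy
  omega

theorem length_of_idxOf (h : ForwardClosed F X) {w : List α} (hw : w ∈ F) {x : α} (hx : x ∈ X)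
    {i : ℕ} (hi : w.idxOf x = i) : i < w.length :=
  hi ▸ List.idxOf_lt_length_iff.2 (h.mem w hw x hx)

/-- Moving a letter of `X` one place forward gives an inequality between the numbers of words
with two prescribed properties, if the move turns the first property into the second. -/
theorem card_filter_le (h : ForwardClosed F X) {x : α} (hx : x ∈ X) (i : ℕ)
    (p q : List α → Prop) [DecidablePred p] [DecidablePred q]
    (hp : ∀ w ∈ F, p w → w.idxOf x = i + 1)
    (hpq : ∀ w ∈ F, i + 1 < w.length → p w → q (w.exchangeAt i)) :
    (F.filter p).card ≤ (F.filter q).card := by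
  apply Finset.card_le_card_of_injOn (List.exchangeAt i)
  · intro w hw
    simp only [Finset.coe_filter, Set.mem_ofPred_eq] at hw ⊢
    have hi := hp w hw.1 hw.2
    exact ⟨h.exchange w hw.1 x hx i hi, hpq w hw.1 (h.length_of_idxOf hw.1 hx hi) hw.2⟩
  · apply (List.injOn_exchangeAt i).mono
    intro w hw
    simp only [Finset.coe_filter, Set.mem_ofPred_eq] at hw ⊢
    exact h.length_of_idxOf hw.1 hx (hp w hw.1 hw.2)

theorem numAt_succ_le (h : ForwardClosed F X) {x : α} (hx : x ∈ X) (i : ℕ) :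
    numAt F x (i + 1) ≤ numAt F x i := by
  apply h.card_filter_le hx i _ _ fun w _ hw => hw
  intro w hw hi hx
  rw [List.idxOf_exchangeAt (h.nodup w hw) hi, hx, Equiv.swap_apply_right]

theorem numFibre_succ_le (h : ForwardClosed F X) {x y : α} (hy : y ∈ X) (hxy : x ≠ y)
    (r j : ℕ) : numFibre F x y r (j + 1) ≤ numFibre F x y r j := by
  apply h.card_filter_le hy j _ _ fun w _ hw => hw.2
  rintro w hw hi ⟨hr, hj⟩
  have hne := (List.idxOf_inj (y := x) (h.mem w hw y hy)).not.2 hxy.symm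
  simp only [posWithout, List.idxOf_exchangeAt (h.nodup w hw) hi, hj,
    Equiv.swap_apply_right] at hr ⊢
  refine ⟨?_, trivial⟩
  rcases eq_or_ne (w.idxOf x) j with hx | hx
  · rw [hx, Equiv.swap_apply_left]
    split_ifs at hr ⊢ <;> omega
  · rw [Equiv.swap_apply_of_ne_of_ne hx (by omega)]
    split_ifs at hr ⊢ <;> omega

theorem sum_numAt_zero_le (h : ForwardClosed F X) : ∑ x ∈ X, numAt F x 0 ≤ F.card := by
  unfold numAt
  rw [← Finset.card_biUnion]
  · exact Finset.card_le_card (Finset.biUnion_subset.2 fun x _ => Finset.filter_subset _ _)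
  · intro x hx y hy hxy
    rw [Function.onFun, Finset.disjoint_filter]
    intro w hw h1 h2
    exact hxy ((List.idxOf_inj (h.mem w hw x hx)).1 (h1.trans h2.symm))

end ForwardClosed

/-! ### Certificates -/

/-- Sums of products with a decreasing sequence of natural numbers are nonnegative when the
partial sums of the other factor are. -/
theorem sum_mul_nonneg_of_antitone {R : Type*} [CommRing R] [LinearOrder R]
    [IsStrictOrderedRing R] (g : ℕ → ℕ) (hg : ∀ j, g (j + 1) ≤ g j) (c : ℕ → R) (n : ℕ)
    (hc : ∀ b, 1 ≤ b → b ≤ n → 0 ≤ ∑ j ∈ Finset.range b, c j) :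
    0 ≤ ∑ j ∈ Finset.range n, (g j : R) * c j := by
  have key : ∀ k, k + 1 ≤ n →
      (g k : R) * ∑ j ∈ Finset.range (k + 1), c j ≤
        ∑ j ∈ Finset.range (k + 1), (g j : R) * c j := by
    intro k
    induction k with
    | zero => intro _; simp
    | succ k ih =>
      intro hk
      rw [Finset.sum_range_succ _ (k + 1), Finset.sum_range_succ _ (k + 1), mul_add]
      have h1 : (g (k + 1) : R) ≤ g k := by exact_mod_cast hg k
      have h2 := mul_le_mul_of_nonneg_right h1 (hc (k + 1) (by omega) (by omega))
      linarith [ih (by omega)]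
  rcases n with _ | n
  · simp
  · exact (mul_nonneg (Nat.cast_nonneg _) (hc (n + 1) (by omega) le_rfl)).trans (key n le_rfl)

/-- A linear-programming certificate for `m + 2` letters in words of length at most `n`, where
positions are counted from zero. The weights `ψ` and `χ` are attached to the positions of the first
and the second letter of a consecutive pair of the chain, and `L` is the weight of an inversion of
the pair. By `fibre`, the weighted count of a pair is a lower bound for `L` times the number of its
inversions. By `mid`, `first` and `last`, the weighted positions of an inner letter, of the first
and of the last letter of the chain have averages at least `e`, `e₁` and `e₂` over the words, once `V`
times the proportion of words that start with the letter is added. These proportions add up to at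
most one, which is why `V` enters `total` only once. -/
structure Certificate (R : Type*) [CommRing R] [LinearOrder R] (m n : ℕ) where
  (ψ χ : ℕ → R)
  (L V e e₁ e₂ : R)
  L_pos : 0 < L
  V_nonneg : 0 ≤ V
  fibre : ∀ r, r + 1 < n → ∀ b, 1 ≤ b → b ≤ n →
    0 ≤ ∑ j ∈ Finset.range b, if j ≤ r then L - ψ (r + 1) + χ j else -ψ r + χ j
  mid : ∀ a, 1 ≤ a → a ≤ n → a * e ≤ ∑ i ∈ Finset.range a, (ψ i - χ i) + V
  first : ∀ a, 1 ≤ a → a ≤ n → a * e₁ ≤ ∑ i ∈ Finset.range a, ψ i + V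
  last : ∀ a, 1 ≤ a → a ≤ n → a * e₂ ≤ ∑ i ∈ Finset.range a, -χ i + V
  total : (m + 1) * L + 3 * V ≤ 3 * (e₁ + e₂ + m * e)

namespace ForwardClosed

variable {α : Type*} [DecidableEq α] {F : Finset (List α)} {X : Finset α}
variable {R : Type*} [CommRing R] [LinearOrder R] [IsStrictOrderedRing R]

omit [LinearOrder R] [IsStrictOrderedRing R] in
theorem sum_idxOf (h : ForwardClosed F X) {n : ℕ} (hn : ∀ w ∈ F, w.length ≤ n)
    {x : α} (hx : x ∈ X) (φ : ℕ → R) :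
    ∑ w ∈ F, φ (w.idxOf x) = ∑ i ∈ Finset.range n, (numAt F x i : R) * φ i := by
  rw [← Finset.sum_fiberwise_of_maps_to (g := fun w : List α => w.idxOf x)
    (t := Finset.range n)]
  · apply Finset.sum_congr rfl
    intro i _
    rw [Finset.sum_congr rfl (g := fun _ => φ i), Finset.sum_const, nsmul_eq_mul]
    · rfl
    · intro w hw
      rw [(Finset.mem_filter.1 hw).2]
  · intro w hw
    exact Finset.mem_range.2 ((h.length_of_idxOf hw hx rfl).trans_le (hn w hw))

theorem card_mul_le_sum_idxOf (h : ForwardClosed F X) {n : ℕ} (hn : ∀ w ∈ F, w.length ≤ n)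
    {x : α} (hx : x ∈ X) (φ : ℕ → R) (V e : R)
    (hφ : ∀ a, 1 ≤ a → a ≤ n → a * e ≤ ∑ i ∈ Finset.range a, φ i + V) :
    F.card * e ≤ ∑ w ∈ F, φ (w.idxOf x) + V * numAt F x 0 := by
  have hs : ∀ b, 1 ≤ b →
      ∑ i ∈ Finset.range b, (if i = 0 then V else 0) = V := by
    intro b hb
    rw [Finset.sum_ite_eq' _ 0 fun _ => V, if_pos (Finset.mem_range.2 hb)]
  have key := sum_mul_nonneg_of_antitone (R := R) (numAt F x) (h.numAt_succ_le hx)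
    (fun i => φ i + (if i = 0 then V else 0) - e) n (by
      intro b hb hbn
      rw [Finset.sum_sub_distrib, Finset.sum_add_distrib, hs b hb]
      simpa using hφ b hb hbn)
  rw [← h.sum_idxOf hn hx, Finset.sum_sub_distrib, Finset.sum_add_distrib] at key
  have h0 : ∑ w ∈ F, (if w.idxOf x = 0 then V else 0) = V * numAt F x 0 := by
    rw [← Finset.sum_filter, Finset.sum_const, nsmul_eq_mul, mul_comm]; rfl
  rw [h0] at key
  simpa using key

omit [LinearOrder R] [IsStrictOrderedRing R] in
theorem sum_posWithout (h : ForwardClosed F X) {n : ℕ} (hn : ∀ w ∈ F, w.length ≤ n)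
    {x y : α} (hx : x ∈ X) (hy : y ∈ X) (hxy : x ≠ y) (f : ℕ → ℕ → R) :
    ∑ w ∈ F, f (posWithout x y w) (w.idxOf y) =
      ∑ r ∈ Finset.range (n - 1), ∑ j ∈ Finset.range n, (numFibre F x y r j : R) * f r j := by
  rw [← Finset.sum_product', ← Finset.sum_fiberwise_of_maps_to
    (g := fun w : List α => (posWithout x y w, w.idxOf y))
    (t := Finset.range (n - 1) ×ˢ Finset.range n)]
  · apply Finset.sum_congr rfl
    rintro ⟨r, j⟩ _
    rw [Finset.sum_congr rfl (g := fun _ => f r j), Finset.sum_const, nsmul_eq_mul]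
    · simp [numFibre, Prod.ext_iff]
    · intro w hw
      obtain ⟨rfl, rfl⟩ := Prod.ext_iff.1 (Finset.mem_filter.1 hw).2
      rfl
  · intro w hw
    have h1 := (h.length_of_idxOf hw hx rfl).trans_le (hn w hw)
    have h2 := (h.length_of_idxOf hw hy rfl).trans_le (hn w hw)
    have h3 := (List.idxOf_inj (y := y) (h.mem w hw x hx)).not.2 hxy
    simp only [Finset.mem_product, Finset.mem_range, posWithout]
    split_ifs <;> omega

/-- The lower bound for the number of inversions of a pair which the weights of a certificate
provide. -/
theorem sum_sub_sum_le_numBefore (h : ForwardClosed F X) {m n : ℕ}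
    (hn : ∀ w ∈ F, w.length ≤ n) (C : Certificate R m n)
    {x y : α} (hx : x ∈ X) (hy : y ∈ X) (hxy : x ≠ y) :
    ∑ w ∈ F, C.ψ (w.idxOf x) - ∑ w ∈ F, C.χ (w.idxOf y) ≤ C.L * numBefore F y x := by
  let f : ℕ → ℕ → R := fun r j => if j ≤ r then C.L - C.ψ (r + 1) + C.χ j else -C.ψ r + C.χ j
  have key : 0 ≤ ∑ w ∈ F, f (posWithout x y w) (w.idxOf y) := by
    rw [h.sum_posWithout hn hx hy hxy]
    apply Finset.sum_nonneg
    intro r hr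
    exact sum_mul_nonneg_of_antitone _ (h.numFibre_succ_le hy hxy r) _ n
      (C.fibre r (by rw [Finset.mem_range] at hr; omega))
  have hf : ∀ w ∈ F, f (posWithout x y w) (w.idxOf y) =
      (if w.idxOf y < w.idxOf x then C.L else 0) - C.ψ (w.idxOf x) + C.χ (w.idxOf y) := by
    intro w hw
    have h3 := (List.idxOf_inj (y := y) (h.mem w hw x hx)).not.2 hxy
    by_cases hlt : w.idxOf y < w.idxOf x
    · simp only [f, posWithout, if_pos hlt]
      rw [if_pos (by omega), Nat.sub_add_cancel (by omega)]
    · simp only [f, posWithout, if_neg hlt]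
      rw [if_neg (by omega), zero_sub]
  rw [Finset.sum_congr rfl hf, Finset.sum_add_distrib, Finset.sum_sub_distrib,
    ← Finset.sum_filter, Finset.sum_const, nsmul_eq_mul] at key
  have : C.L * numBefore F y x =
    ((F.filter fun w => w.idxOf y < w.idxOf x).card : R) * C.L := mul_comm _ _
  linarith

/-- If no two letters of `X` are balanced, then `X` can be listed so that each letter comes before
its successor in more than two thirds of the words. This is the existence of a Hamiltonian path in
a tournament. -/
theorem exists_isChain_numBefore
    (hun : ∀ x ∈ X, ∀ y ∈ X, x ≠ y →
      3 * numBefore F x y < F.card ∨ 3 * numBefore F y x < F.card) :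
    ∃ l : List α, l.Nodup ∧ l.toFinset = X ∧
      l.IsChain fun x y => 3 * numBefore F y x < F.card := by
  -- Inserting `z` into a chain leaves the head unchanged or puts `z` there.
  have insert : ∀ (z : α) (l : List α),
      (∀ x ∈ l, 3 * numBefore F x z < F.card ∨ 3 * numBefore F z x < F.card) →
      l.IsChain (fun x y => 3 * numBefore F y x < F.card) →
      ∃ l' : List α, l'.Perm (z :: l) ∧ (l'.head? = some z ∨ l'.head? = l.head?) ∧
        l'.IsChain fun x y => 3 * numBefore F y x < F.card := by
    intro z l
    induction l with
    | nil => exact fun _ _ => ⟨[z], List.Perm.refl _, by simp, by simp⟩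
    | cons a l ih =>
      intro hz hc
      rcases hz a (by simp) with ha | ha
      · exact ⟨z :: a :: l, List.Perm.refl _, by simp, List.isChain_cons_cons.2 ⟨ha, hc⟩⟩
      · obtain ⟨l', hp, hh, hc'⟩ := ih (fun x hx => hz x (by simp [hx])) hc.tail
        refine ⟨a :: l', (hp.cons a).trans (List.Perm.swap _ _ _), by simp, ?_⟩
        rw [List.isChain_cons] at hc ⊢
        refine ⟨fun y hy => ?_, hc'⟩
        rcases hh with hh | hh
        · rw [hh] at hy
          cases hy
          exact ha
        · exact hc.1 y (hh ▸ hy)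
  have build : ∀ Y : Finset α, Y ⊆ X → ∃ l : List α, l.Nodup ∧ l.toFinset = Y ∧
      l.IsChain fun x y => 3 * numBefore F y x < F.card := by
    intro Y
    induction Y using Finset.induction_on with
    | empty => exact fun _ => ⟨[], by simp, by simp, by simp⟩
    | insert z Y hz ih =>
      intro hY
      obtain ⟨l, hl, rfl, hc⟩ := ih fun y hy => hY (Finset.mem_insert_of_mem hy)
      obtain ⟨l', hp, -, hc'⟩ := insert z l (fun x hx => hun x
        (hY (Finset.mem_insert_of_mem (List.mem_toFinset.2 hx))) z
        (hY (Finset.mem_insert_self _ _)) (fun he => hz (he ▸ List.mem_toFinset.2 hx))) hc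
      refine ⟨l', hp.nodup_iff.2 (List.nodup_cons.2 ⟨fun hm => hz (List.mem_toFinset.2 hm), hl⟩),
        ?_, hc'⟩
      rw [List.toFinset_eq_of_perm _ _ hp, List.toFinset_cons]
  exact build X subset_rfl

/-- Adding the inequalities of a certificate along a chain of unbalanced pairs. -/
theorem sum_chain_lt (h : ForwardClosed F X) {m n : ℕ}
    (hn : ∀ w ∈ F, w.length ≤ n) (C : Certificate R m n) (l : List α) :
    ∀ x y : α, (x :: y :: l).Nodup → (∀ z ∈ x :: y :: l, z ∈ X) →
      (x :: y :: l).IsChain (fun x y => 3 * numBefore F y x < F.card) →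
      3 * (∑ w ∈ F, C.ψ (w.idxOf x) + F.card * C.e₂ + l.length * (F.card * C.e)) <
        (l.length + 1) * (C.L * F.card) +
          3 * (C.V * ((y :: l).map fun z => (numAt F z 0 : R)).sum) := by
  have step : ∀ x ∈ X, ∀ y ∈ X, x ≠ y → 3 * numBefore F y x < F.card →
      3 * (∑ w ∈ F, C.ψ (w.idxOf x) - ∑ w ∈ F, C.χ (w.idxOf y)) < C.L * F.card := by
    intro x hx y hy hxy hlt
    have h1 := h.sum_sub_sum_le_numBefore hn C hx hy hxy
    have h2 : (3 * numBefore F y x : R) < F.card := by exact_mod_cast hlt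
    have h3 := mul_lt_mul_of_pos_left h2 C.L_pos
    linarith
  induction l with
  | nil =>
    intro x y hnd hX hc
    simp only [List.isChain_cons_cons] at hc
    have h1 := step x (hX x (by simp)) y (hX y (by simp)) (by simpa using hnd) hc.1
    have h2 := h.card_mul_le_sum_idxOf hn (hX y (by simp)) (fun i => -C.χ i) C.V C.e₂ C.last
    rw [Finset.sum_neg_distrib] at h2
    simp only [List.length_nil, Nat.cast_zero, zero_mul, zero_add, one_mul, List.map_cons,
      List.map_nil, List.sum_cons, List.sum_nil, add_zero]
    linarith
  | cons z l ih =>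
    intro x y hnd hX hc
    rw [List.isChain_cons_cons] at hc
    have hxy : x ≠ y := by
      rintro rfl
      simp at hnd
    have h1 := step x (hX x (by simp)) y (hX y (by simp)) hxy hc.1
    have h2 := h.card_mul_le_sum_idxOf hn (hX y (by simp)) (fun i => C.ψ i - C.χ i) C.V C.e C.mid
    have h3 := ih y z hnd.of_cons (fun t ht => hX t (List.mem_cons_of_mem _ ht)) hc.2
    rw [Finset.sum_sub_distrib] at h2
    rw [List.map_cons, List.sum_cons, mul_add C.V]
    simp only [List.length_cons, Nat.cast_add, Nat.cast_one] at h3 ⊢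
    linarith

/-- A certificate forces a balanced pair among the letters which move freely to the front. -/
theorem exists_balanced_of_certificate (h : ForwardClosed F X) (hF : F.Nonempty) {m n : ℕ}
    (hn : ∀ w ∈ F, w.length ≤ n) (hm : X.card = m + 2) (C : Certificate R m n) :
    ∃ x ∈ X, ∃ y ∈ X, x ≠ y ∧ F.card ≤ 3 * numBefore F x y ∧ F.card ≤ 3 * numBefore F y x := by
  by_contra! hcon
  obtain ⟨l, hnd, hl, hc⟩ := exists_isChain_numBefore fun x hx y hy hxy => by
    by_contra! hle
    exact absurd (hcon x hx y hy hxy hle.1) (not_lt.2 hle.2)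
  have hlen : l.length = m + 2 := by rw [← hm, ← hl, List.toFinset_card_of_nodup hnd]
  match l, hlen with
  | x :: y :: l, hlen =>
    have hX : ∀ z ∈ x :: y :: l, z ∈ X := fun z hz => hl ▸ List.mem_toFinset.2 hz
    have h1 := h.sum_chain_lt hn C l x y hnd hX hc
    have h2 := h.card_mul_le_sum_idxOf hn (hX x (by simp)) C.ψ C.V C.e₁ C.first
    have h3 : (((x :: y :: l).map fun z => (numAt F z 0 : R)).sum) ≤ F.card := by
      rw [← List.sum_toFinset _ hnd, hl]
      exact_mod_cast h.sum_numAt_zero_le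
    have h4 := mul_le_mul_of_nonneg_left h3 C.V_nonneg
    have h5 : (0 : R) < F.card := by exact_mod_cast hF.card_pos
    have h6 := mul_le_mul_of_nonneg_right C.total h5.le
    have h7 : l.length = m := by simpa using hlen
    rw [h7] at h1
    rw [List.map_cons, List.sum_cons, mul_add] at h4
    linarith

end ForwardClosed

/-! ### Certificates given by tables -/

/-- The conditions on an integral certificate, in a form that can be decided by evaluation. -/
def CertificateCheck (m n : ℕ) (ψ χ : ℕ → ℤ) (L V e e₁ e₂ : ℤ) : Prop :=
  (∀ r < n - 1, ∀ b < n,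
    0 ≤ ∑ j ∈ Finset.range (b + 1), if j ≤ r then L - ψ (r + 1) + χ j else -ψ r + χ j) ∧
  (∀ a < n, (a + 1 : ℕ) * e ≤ ∑ i ∈ Finset.range (a + 1), (ψ i - χ i) + V) ∧
  (∀ a < n, (a + 1 : ℕ) * e₁ ≤ ∑ i ∈ Finset.range (a + 1), ψ i + V) ∧
  (∀ a < n, (a + 1 : ℕ) * e₂ ≤ ∑ i ∈ Finset.range (a + 1), -χ i + V) ∧
  (m + 1) * L + 3 * V ≤ 3 * (e₁ + e₂ + m * e)

instance (m n : ℕ) (ψ χ : ℕ → ℤ) (L V e e₁ e₂ : ℤ) :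
    Decidable (CertificateCheck m n ψ χ L V e e₁ e₂) := by
  unfold CertificateCheck; infer_instance

/-- An integral certificate from a successful check. -/
def CertificateCheck.certificate {m n : ℕ} {ψ χ : ℕ → ℤ} {L V e e₁ e₂ : ℤ}
    (h : CertificateCheck m n ψ χ L V e e₁ e₂) (hL : 0 < L) (hV : 0 ≤ V) :
    Certificate ℤ m n where
  ψ := ψ
  χ := χ
  L := L
  V := V
  e := e
  e₁ := e₁
  e₂ := e₂
  L_pos := hL
  V_nonneg := hV
  fibre r hr b hb hbn := by
    obtain ⟨b, rfl⟩ := Nat.exists_eq_succ_of_ne_zero (by omega : b ≠ 0)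
    exact h.1 r (by omega) b hbn
  mid a ha han := by
    obtain ⟨a, rfl⟩ := Nat.exists_eq_succ_of_ne_zero (by omega : a ≠ 0)
    exact h.2.1 a han
  first a ha han := by
    obtain ⟨a, rfl⟩ := Nat.exists_eq_succ_of_ne_zero (by omega : a ≠ 0)
    exact h.2.2.1 a han
  last a ha han := by
    obtain ⟨a, rfl⟩ := Nat.exists_eq_succ_of_ne_zero (by omega : a ≠ 0)
    exact h.2.2.2.1 a han
  total := h.2.2.2.2

/-- Constant weights suffice for two letters in words of length three. -/
theorem certificateCheck_two_three :
    CertificateCheck 0 3 (fun _ => 1) (fun _ => 0) 3 0 1 1 0 := by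
  decide +kernel

/-- The weights are an optimal solution of the linear program for four letters and words of length
eight. -/
theorem certificateCheck_four_eight :
    CertificateCheck 2 8 ([-3, 0, 0, 4, 2, 6, 6, 6].getD · 0)
      ([-6, -6, -6, -3, -3, 0, 0, 0].getD · 0) 12 3 6 0 3 := by
  decide +kernel

/-- For `m + 2` letters in words of length `n = 2 (m + 2)`, the first weight at position `i` is the
truncated root `min 1 √(1.2 (i + 1) / n)`, the second is `0.6 (j + 1) / n`, both in thousandths and
rounded down and up, respectively. The factor `0.6`
instead of the `0.5` for long words leaves more room when the words are short. -/
theorem certificateCheck_sqrt : ∀ m < 18, 3 ≤ m →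
    CertificateCheck m (2 * (m + 2))
      (fun i => (min 1000 (Nat.sqrt (1200000 * (i + 1) / (2 * (m + 2)))) : ℕ))
      (fun j => ((600 * (j + 1) + (2 * (m + 2) - 1)) / (2 * (m + 2)) : ℕ))
      1000 (110 * m + 18) 467 580 (-296) := by
  decide +kernel

/-! ### Square-root certificates for long words -/

/-- The weight `√((i + 1) / n)` of position `i`. -/
noncomputable def sqrtWeight (n i : ℕ) : ℝ := √((i + 1) / n)

theorem le_sum_sqrtWeight {n : ℕ} (hn : 0 < n) (a : ℕ) :
    2 / 3 * n * √(a / n) ^ 3 + 1 / 3 * √(a / n) ≤ ∑ i ∈ Finset.range a, sqrtWeight n i := by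
  have hn' : (0 : ℝ) < n := by exact_mod_cast hn
  induction a with
  | zero => simp
  | succ a ih =>
    rw [Finset.sum_range_succ, sqrtWeight]
    have hu0 := Real.sqrt_nonneg ((a : ℝ) / n)
    have hu : √((a : ℝ) / n) ^ 2 = a / n := Real.sq_sqrt (by positivity)
    have hv : √(((a : ℝ) + 1) / n) ^ 2 = (a + 1) / n := Real.sq_sqrt (by positivity)
    have huv : √((a : ℝ) / n) ≤ √(((a : ℝ) + 1) / n) := by
      apply Real.sqrt_le_sqrt; gcongr; linarith
    push_cast
    set u := √((a : ℝ) / n)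
    set v := √(((a : ℝ) + 1) / n)
    have huv2 : n * v ^ 2 = n * u ^ 2 + 1 := by
      rw [hu, hv]; field_simp
    have h1 : 2 * n * u * (v - u) ≤ 1 := by
      nlinarith [mul_nonneg hn'.le (sq_nonneg (v - u))]
    have h2 : n * v ^ 3 = (n * u ^ 2 + 1) * v := by rw [← huv2]; ring
    nlinarith [mul_le_mul_of_nonneg_left h1 hu0]

theorem sum_range_add_one_div (n a : ℕ) :
    ∑ i ∈ Finset.range a, ((i + 1 : ℝ) / (2 * n)) = a * (a + 1) / (4 * n) := by
  rw [← Finset.sum_div]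
  have : ∑ i ∈ Finset.range a, (i + 1 : ℝ) = a * (a + 1) / 2 := by
    induction a with
    | zero => simp
    | succ a ih => rw [Finset.sum_range_succ, ih]; push_cast; ring
  rw [this, div_div, ← mul_assoc]; congr 2; ring

theorem sum_range_ite_le {R : Type*} [CommRing R] (r b : ℕ) (c d : R) (χ : ℕ → R) :
    ∑ j ∈ Finset.range b, (if j ≤ r then c + χ j else d + χ j) =
      (min b (r + 1) : ℕ) * c + (b - (r + 1) : ℕ) * d + ∑ j ∈ Finset.range b, χ j := by
  induction b with
  | zero => simp
  | succ b ih =>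
    rw [Finset.sum_range_succ, ih, Finset.sum_range_succ]
    split_ifs with h
    · rw [min_eq_left (by omega), min_eq_left (by omega), Nat.sub_eq_zero_of_le (by omega),
        Nat.sub_eq_zero_of_le (by omega)]
      push_cast; ring
    · rw [min_eq_right (by omega), min_eq_right (by omega), Nat.succ_sub (by omega)]
      push_cast; ring

/-- The fibre inequality for the square-root weights. For `b` beyond `p = r + 1` it is the
quadratic inequality `z ^ 2 + z + 1 / 4 ≥ 0` at `z = b - 2 √(p n)`, up to an error which is
controlled by the strict concavity of the root. -/
theorem sqrtWeight_fibre {n : ℕ} (r : ℕ) (hr : r + 1 < n) (b : ℕ) :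
    (0 : ℝ) ≤ ∑ j ∈ Finset.range b, if j ≤ r then 1 - sqrtWeight n (r + 1) + (j + 1) / (2 * n)
      else -sqrtWeight n r + (j + 1) / (2 * n) := by
  have hn' : (0 : ℝ) < n := by exact_mod_cast (by omega : 0 < n)
  have hn1 : (1 : ℝ) ≤ n := by exact_mod_cast (by omega : 1 ≤ n)
  rw [sum_range_ite_le, sum_range_add_one_div]
  have hA : sqrtWeight n (r + 1) ^ 2 = (r + 2) / n := by
    rw [sqrtWeight, Real.sq_sqrt (by positivity)]; push_cast; ring
  have hB : sqrtWeight n r ^ 2 = (r + 1) / n := Real.sq_sqrt (by positivity)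
  have hA0 : 0 ≤ sqrtWeight n (r + 1) := Real.sqrt_nonneg _
  have hB0 : 0 ≤ sqrtWeight n r := Real.sqrt_nonneg _
  set A := sqrtWeight n (r + 1)
  set B := sqrtWeight n r
  have hA1 : A ≤ 1 := by
    have : A ^ 2 ≤ 1 := by
      rw [hA, div_le_one hn']; exact_mod_cast hr
    nlinarith
  have hAn : n * A ^ 2 = r + 2 := by rw [hA]; field_simp
  have hBn : n * B ^ 2 = r + 1 := by rw [hB]; field_simp
  have hr0 : (0 : ℝ) ≤ r := Nat.cast_nonneg r
  have hBA : B ≤ A := by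
    by_contra! hlt
    nlinarith [mul_pos hn' (sub_pos.2 hlt)]
  rcases le_total b (r + 1) with hb | hb
  · rw [min_eq_left hb, Nat.sub_eq_zero_of_le hb]
    have : (0 : ℝ) ≤ b * (1 - A) := mul_nonneg (Nat.cast_nonneg _) (by linarith)
    have : (0 : ℝ) ≤ b * (b + 1) / (4 * n) := by positivity
    push_cast
    linarith
  · rw [min_eq_right hb, Nat.cast_sub hb]
    push_cast
    have hD : n * (A - B) * (A + B) = 1 := by linarith
    have h8 : (A + B) ^ 2 ≤ 8 * B := by
      -- Here `n (A + B) ^ 2 ≤ 2 n (A ^ 2 + B ^ 2) = 4 n B ^ 2 + 2`, and `B ^ 2 ≤ B`, `1 ≤ n B`.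
      have hB1 : 1 ≤ n * B := by nlinarith
      have : n * (A + B) ^ 2 ≤ n * (8 * B) := by nlinarith [sq_nonneg (A - B)]
      exact le_of_mul_le_mul_left this hn'
    have h1 : 1 ≤ 8 * B * (n * (A - B)) ^ 2 := by
      have := mul_le_mul_of_nonneg_right h8 (sq_nonneg (n * (A - B)))
      have h2 : (A + B) ^ 2 * (n * (A - B)) ^ 2 = 1 := by
        rw [← mul_pow, mul_comm, hD, one_pow]
      linarith
    have h2 : 4 * n * ((r + 1) * (A - B)) ≤ 2 * n * B - 1 / 4 := by
      have h3 : 4 * n * (n * B ^ 2 * (A - B)) = 2 * n * B - 2 * B * (n * (A - B)) ^ 2 := by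
        linear_combination (2 * n * B) * hD
      rw [← hBn, h3]; linarith
    have h4 : (b : ℝ) * (b + 1) / (4 * n) * (4 * n) = b * (b + 1) := by field_simp
    refine nonneg_of_mul_nonneg_left ?_ (by positivity : (0 : ℝ) < 4 * n)
    have h5 : 4 * n * (n * B ^ 2) = 4 * n * (r + 1) := by rw [hBn]
    nlinarith [sq_nonneg (b - 2 * n * B + 1 / 2)]

/-- The certificate with weights `√((i + 1) / n)` and `(j + 1) / (2 n)`. With `t = √(a / n)`, its
conditions are polynomial inequalities for `t` in the unit interval. -/
noncomputable def sqrtCertificate (m : ℕ) (hm : 18 ≤ m) : Certificate ℝ m (2 * (m + 2)) where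
  ψ := sqrtWeight (2 * (m + 2))
  χ j := (j + 1) / (2 * (2 * (m + 2) : ℕ))
  L := 1
  V := (2 * (m + 2) : ℕ) / 20
  e := 4455 / 10000
  e₁ := 53 / 100
  e₂ := -(20625 / 100000)
  L_pos := one_pos
  V_nonneg := by positivity
  fibre r hr b _ _ := sqrtWeight_fibre r hr b
  mid a ha han := by
    have hn : 0 < 2 * (m + 2) := by omega
    have h1 := le_sum_sqrtWeight hn a
    have hn' : (0 : ℝ) < (2 * (m + 2) : ℕ) := by exact_mod_cast hn
    rw [Finset.sum_sub_distrib, sum_range_add_one_div]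
    have ha' : (a : ℝ) ≤ (2 * (m + 2) : ℕ) := by exact_mod_cast han
    set n : ℝ := ((2 * (m + 2) : ℕ) : ℝ)
    have ht : √((a : ℝ) / n) ^ 2 = a / n := Real.sq_sqrt (by positivity)
    have ht0 := Real.sqrt_nonneg ((a : ℝ) / n)
    have ht1 : √((a : ℝ) / n) ≤ 1 := Real.sqrt_le_one.2 ((div_le_one hn').2 ha')
    set t := √((a : ℝ) / n)
    have hat : (a : ℝ) = n * t ^ 2 := by rw [ht]; field_simp
    have h2 : (a : ℝ) * (a + 1) / (4 * n) = n * t ^ 4 / 4 + t ^ 2 / 4 := by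
      rw [hat]; field_simp
    -- The minimum over the unit interval is close to `t = 27 / 40`.
    have h3 : 0 ≤ 2 / 3 * t ^ 3 - t ^ 4 / 4 - 4455 / 10000 * t ^ 2 + 1 / 20 := by
      nlinarith [mul_nonneg (sq_nonneg (t - 27 / 40)) ht0,
        mul_nonneg (mul_nonneg (sq_nonneg (t - 27 / 40)) ht0) (sub_nonneg.2 ht1),
        sq_nonneg (t - 27 / 40)]
    have h4 := mul_nonneg hn'.le h3
    rw [h2, hat]
    nlinarith
  first a ha han := by
    have hn : 0 < 2 * (m + 2) := by omega
    have h1 := le_sum_sqrtWeight hn a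
    have hn' : (0 : ℝ) < (2 * (m + 2) : ℕ) := by exact_mod_cast hn
    set n : ℝ := ((2 * (m + 2) : ℕ) : ℝ)
    have ht : √((a : ℝ) / n) ^ 2 = a / n := Real.sq_sqrt (by positivity)
    have ht0 := Real.sqrt_nonneg ((a : ℝ) / n)
    set t := √((a : ℝ) / n)
    have hat : (a : ℝ) = n * t ^ 2 := by rw [ht]; field_simp
    -- The minimum over `t ≥ 0` is attained at `t = 53 / 100`.
    have h3 : 0 ≤ 2 / 3 * t ^ 3 - 53 / 100 * t ^ 2 + 1 / 20 := by
      nlinarith [mul_nonneg (sq_nonneg (t - 53 / 100)) ht0, sq_nonneg (t - 53 / 100)]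
    have h4 := mul_nonneg hn'.le h3
    rw [hat]
    nlinarith
  last a ha han := by
    have hn' : (40 : ℝ) ≤ (2 * (m + 2) : ℕ) := by exact_mod_cast (by omega : 40 ≤ 2 * (m + 2))
    rw [Finset.sum_neg_distrib, sum_range_add_one_div]
    have ha' : (a : ℝ) ≤ (2 * (m + 2) : ℕ) := by exact_mod_cast han
    have ha0 : (0 : ℝ) ≤ a := Nat.cast_nonneg a
    set n : ℝ := ((2 * (m + 2) : ℕ) : ℝ)
    have h2 : (a : ℝ) * (a + 1) / (4 * n) ≤ n / 20 + a / 5 + a / 160 := by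
      rw [div_le_iff₀ (by linarith)]
      nlinarith [mul_nonneg (sub_nonneg.2 ha') (by linarith : 0 ≤ a + n / 5),
        mul_nonneg ha0 (sub_nonneg.2 hn')]
    linarith
  total := by
    have : (18 : ℝ) ≤ m := by exact_mod_cast hm
    push_cast
    linarith

/-! ### Three letters in words of length six -/

/-- The number of words of `F` with `x` at position `i` and `y` at position `j`. -/
def numCell {α : Type*} [DecidableEq α] (F : Finset (List α)) (x y : α) (i j : ℕ) : ℕ :=
  (F.filter fun w => w.idxOf x = i ∧ w.idxOf y = j).card

namespace ForwardClosed

variable {α : Type*} [DecidableEq α] {F : Finset (List α)} {X : Finset α}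

theorem numCell_comm (F : Finset (List α)) (x y : α) (i j : ℕ) :
    numCell F x y i j = numCell F y x j i := by
  simp only [numCell, and_comm]

theorem numCell_succ_le (h : ForwardClosed F X) {x : α} (hx : x ∈ X) (y : α) (i j : ℕ)
    (hj : j ≠ i) (hj' : j ≠ i + 1) : numCell F x y (i + 1) j ≤ numCell F x y i j := by
  apply h.card_filter_le hx i _ _ fun w _ hw => hw.1
  rintro w hw hi ⟨h1, h2⟩
  rw [List.idxOf_exchangeAt (h.nodup w hw) hi, List.idxOf_exchangeAt (h.nodup w hw) hi, h1, h2,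
    Equiv.swap_apply_right, Equiv.swap_apply_of_ne_of_ne hj hj']
  exact ⟨rfl, rfl⟩

theorem numCell_swap (h : ForwardClosed F X) {x y : α} (hx : x ∈ X) (hy : y ∈ X) (i : ℕ) :
    numCell F x y (i + 1) i = numCell F x y i (i + 1) := by
  apply le_antisymm
  · apply h.card_filter_le hx i _ _ fun w _ hw => hw.1
    rintro w hw hi ⟨h1, h2⟩
    rw [List.idxOf_exchangeAt (h.nodup w hw) hi, List.idxOf_exchangeAt (h.nodup w hw) hi, h1, h2,
      Equiv.swap_apply_right, Equiv.swap_apply_left]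
    exact ⟨rfl, rfl⟩
  · apply h.card_filter_le hy i _ _ fun w _ hw => hw.2
    rintro w hw hi ⟨h1, h2⟩
    rw [List.idxOf_exchangeAt (h.nodup w hw) hi, List.idxOf_exchangeAt (h.nodup w hw) hi, h1, h2,
      Equiv.swap_apply_right, Equiv.swap_apply_left]
    exact ⟨rfl, rfl⟩

theorem numCell_self (h : ForwardClosed F X) {x y : α} (hx : x ∈ X) (hxy : x ≠ y) (i : ℕ) :
    numCell F x y i i = 0 := by
  rw [numCell, Finset.card_eq_zero, Finset.filter_eq_empty_iff]
  rintro w hw ⟨h1, h2⟩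
  exact hxy ((List.idxOf_inj (h.mem w hw x hx)).1 (h1.trans h2.symm))

/-- A count of words that depends on the positions of `x` and `y` only, as a sum over cells. -/
theorem card_filter_eq_sum_numCell (h : ForwardClosed F X) {n : ℕ}
    (hn : ∀ w ∈ F, w.length ≤ n) {x y : α} (hx : x ∈ X) (hy : y ∈ X)
    (p : ℕ → ℕ → Prop) [∀ i j, Decidable (p i j)] :
    (F.filter fun w => p (w.idxOf x) (w.idxOf y)).card =
      ∑ i ∈ Finset.range n, ∑ j ∈ Finset.range n, if p i j then numCell F x y i j else 0 := by
  rw [← Finset.sum_product', Finset.card_eq_sum_card_fiberwise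
    (f := fun w : List α => (w.idxOf x, w.idxOf y)) (t := Finset.range n ×ˢ Finset.range n)]
  · apply Finset.sum_congr rfl
    rintro ⟨i, j⟩ _
    rw [Finset.filter_filter]
    split_ifs with hp
    · rw [numCell]
      congr 1
      apply Finset.filter_congr
      intro w _
      rw [Prod.ext_iff]
      constructor
      · exact fun hw => hw.2
      · rintro ⟨rfl, rfl⟩
        exact ⟨hp, rfl, rfl⟩
    · rw [Finset.card_eq_zero, Finset.filter_eq_empty_iff]
      rintro w _ ⟨hw, he⟩
      obtain ⟨rfl, rfl⟩ := Prod.ext_iff.1 he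
      exact hp hw
  · intro w hw
    have hw := (Finset.mem_filter.1 hw).1
    have h1 := (h.length_of_idxOf hw hx rfl).trans_le (hn w hw)
    have h2 := (h.length_of_idxOf hw hy rfl).trans_le (hn w hw)
    simpa using ⟨h1, h2⟩

theorem numAt_eq_sum_numCell (h : ForwardClosed F X) {n : ℕ} (hn : ∀ w ∈ F, w.length ≤ n)
    {x y : α} (hx : x ∈ X) (hy : y ∈ X) {i : ℕ} (hi : i < n) :
    numAt F x i = ∑ j ∈ Finset.range n, numCell F x y i j := by
  rw [numAt, h.card_filter_eq_sum_numCell hn hx hy fun k _ => k = i, Finset.sum_eq_single i]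
  · simp
  · intro k _ hk
    simp [hk]
  · exact fun hni => absurd (Finset.mem_range.2 hi) hni

/-- The linear program behind the case of three letters and six positions is infeasible. Here `f`
and `g` stand for the numbers of words with prescribed positions of the first two and of the last
two letters of the chain. -/
theorem false_of_cells (f g : ℕ → ℕ → ℤ)
    (hf₀ : ∀ i j, 0 ≤ f i j) (hg₀ : ∀ i j, 0 ≤ g i j)
    (hf : ∀ i, f i i = 0) (hg : ∀ i, g i i = 0)
    (hf₁ : ∀ i j, j ≠ i → j ≠ i + 1 → f (i + 1) j ≤ f i j)
    (hf₂ : ∀ i j, i ≠ j → i ≠ j + 1 → f i (j + 1) ≤ f i j)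
    (hg₂ : ∀ i j, i ≠ j → i ≠ j + 1 → g i (j + 1) ≤ g i j)
    (hf₃ : ∀ i, f (i + 1) i = f i (i + 1)) (hg₃ : ∀ i, g (i + 1) i = g i (i + 1))
    (hfg : ∀ i < 6, ∑ j ∈ Finset.range 6, f j i = ∑ j ∈ Finset.range 6, g i j)
    (hf₄ : 2 * ∑ i ∈ Finset.range 6, ∑ j ∈ Finset.range 6, (if j < i then f i j else 0) <
      ∑ i ∈ Finset.range 6, ∑ j ∈ Finset.range 6, if i < j then f i j else 0)
    (hg₄ : 2 * ∑ i ∈ Finset.range 6, ∑ j ∈ Finset.range 6, (if j < i then g i j else 0) <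
      ∑ i ∈ Finset.range 6, ∑ j ∈ Finset.range 6, if i < j then g i j else 0)
    (hfirst : ∑ j ∈ Finset.range 6, f 0 j + ∑ j ∈ Finset.range 6, f j 0 +
      ∑ j ∈ Finset.range 6, g j 0 ≤ ∑ i ∈ Finset.range 6, ∑ j ∈ Finset.range 6, f i j) :
    False := by
  have m0 := hfg 0 (by decide)
  have m1 := hfg 1 (by decide)
  have m2 := hfg 2 (by decide)
  have m3 := hfg 3 (by decide)
  have m4 := hfg 4 (by decide)
  have m5 := hfg 5 (by decide)
  clear hfg
  simp only [Finset.sum_range_succ, Finset.sum_range_zero, zero_add, hf, hg] at m0 m1 m2 m3 m4 m5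
  simp [Finset.sum_range_succ] at hf₄
  simp [Finset.sum_range_succ] at hg₄
  simp only [Finset.sum_range_succ, Finset.sum_range_zero, zero_add, hf, hg] at hfirst
  linarith [
    hf₂ 0 1 (by decide) (by decide), hf₁ 0 4 (by decide) (by decide), hf₁ 0 5 (by decide)
    (by decide), hf₂ 1 2 (by decide) (by decide), hf₂ 2 0 (by decide) (by decide), hf₂ 2 3
    (by decide) (by decide), hf₁ 2 4 (by decide) (by decide), hf₂ 2 4 (by decide) (by
    decide), hf₁ 2 5 (by decide) (by decide), hf₀ 2 5, hf₂ 3 0 (by decide) (by decide), hf₂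
    3 1 (by decide) (by decide), hf₁ 3 5 (by decide) (by decide), hf₁ 4 0 (by decide) (by
    decide), hf₁ 4 1 (by decide) (by decide), hf₁ 4 2 (by decide) (by decide), hf₁ 4 3 (by
    decide) (by decide), hf₀ 5 0, hf₀ 5 1, hf₂ 5 2 (by decide) (by decide), hf₀ 5 3, hf₀ 5
    4, hf₃ 0, hf₃ 1, hf₃ 2, hg₂ 0 1 (by decide) (by decide), hg₂ 0 2 (by decide) (by
    decide), hg₂ 0 3 (by decide) (by decide), hg₂ 0 4 (by decide) (by decide), hg₂ 1 2 (by
    decide) (by decide), hg₂ 1 3 (by decide) (by decide), hg₂ 1 4 (by decide) (by decide),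
    hg₂ 2 0 (by decide) (by decide), hg₂ 2 3 (by decide) (by decide), hg₂ 2 4 (by decide)
    (by decide), hg₂ 3 0 (by decide) (by decide), hg₂ 3 1 (by decide) (by decide), hg₂ 3 4
    (by decide) (by decide), hg₂ 4 0 (by decide) (by decide), hg₂ 4 1 (by decide) (by
    decide), hg₂ 4 2 (by decide) (by decide), hg₀ 5 0, hg₂ 5 1 (by decide) (by decide), hg₀
    5 1, hg₂ 5 2 (by decide) (by decide), hg₂ 5 3 (by decide) (by decide), hg₃ 0, hg₃ 1, hg₃
    2, hg₃ 3, hg₃ 4]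

theorem exists_balanced_three_six (h : ForwardClosed F X) (hn : ∀ w ∈ F, w.length ≤ 6)
    (hm : X.card = 3) :
    ∃ x ∈ X, ∃ y ∈ X, x ≠ y ∧ F.card ≤ 3 * numBefore F x y ∧ F.card ≤ 3 * numBefore F y x := by
  by_contra! hcon
  obtain ⟨l, hnd, hl, hc⟩ := exists_isChain_numBefore fun x hx y hy hxy => by
    by_contra! hle
    exact absurd (hcon x hx y hy hxy hle.1) (not_lt.2 hle.2)
  have hlen : l.length = 3 := by rw [← hm, ← hl, List.toFinset_card_of_nodup hnd]
  obtain ⟨a, b, c, rfl⟩ := List.length_eq_three.1 hlen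
  have ha : a ∈ X := hl ▸ List.mem_toFinset.2 (by simp)
  have hb : b ∈ X := hl ▸ List.mem_toFinset.2 (by simp)
  have hc' : c ∈ X := hl ▸ List.mem_toFinset.2 (by simp)
  simp only [List.nodup_cons, List.mem_cons, List.not_mem_nil, or_false, not_or] at hnd
  simp only [List.isChain_cons_cons, List.isChain_singleton, and_true] at hc
  have hab := h.numBefore_add_numBefore ha hnd.1.1
  have hbc := h.numBefore_add_numBefore hb hnd.2.1
  have hab' : 2 * numBefore F b a < numBefore F a b := by omega
  have hbc' : 2 * numBefore F c b < numBefore F b c := by omega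
  have hlt : ∀ x ∈ X, ∀ y ∈ X, numBefore F x y =
      ∑ i ∈ Finset.range 6, ∑ j ∈ Finset.range 6, if i < j then numCell F x y i j else 0 :=
    fun x hx y hy => h.card_filter_eq_sum_numCell hn hx hy fun i j => i < j
  have hgt : ∀ x ∈ X, ∀ y ∈ X, numBefore F y x =
      ∑ i ∈ Finset.range 6, ∑ j ∈ Finset.range 6, if j < i then numCell F x y i j else 0 :=
    fun x hx y hy => h.card_filter_eq_sum_numCell hn hx hy fun i j => j < i
  have hall : F.card =
      ∑ i ∈ Finset.range 6, ∑ j ∈ Finset.range 6, numCell F a b i j := by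
    simpa using h.card_filter_eq_sum_numCell hn ha hb fun _ _ => True
  have hfirst := h.sum_numAt_zero_le
  rw [← hl, List.sum_toFinset _ (by simpa using hnd)] at hfirst
  simp only [List.map_cons, List.map_nil, List.sum_cons, List.sum_nil, add_zero] at hfirst
  rw [hall, h.numAt_eq_sum_numCell hn ha hb (by decide),
    h.numAt_eq_sum_numCell hn hb ha (by decide),
    h.numAt_eq_sum_numCell hn hc' hb (by decide)] at hfirst
  simp only [numCell_comm F b a, numCell_comm F c b] at hfirst
  rw [hlt a ha b hb, hgt a ha b hb] at hab'
  rw [hlt b hb c hc', hgt b hb c hc'] at hbc'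
  apply false_of_cells (fun i j => numCell F a b i j) (fun i j => numCell F b c i j)
  · exact fun _ _ => Nat.cast_nonneg _
  · exact fun _ _ => Nat.cast_nonneg _
  · exact fun i => by exact_mod_cast h.numCell_self ha hnd.1.1 i
  · exact fun i => by exact_mod_cast h.numCell_self hb hnd.2.1 i
  · exact fun i j hi hj => by exact_mod_cast h.numCell_succ_le ha b i j hi hj
  · intro i j hi hj
    rw [numCell_comm F a b i, numCell_comm F a b i]
    exact_mod_cast h.numCell_succ_le hb a j i hi hj
  · intro i j hi hj
    rw [numCell_comm F b c i, numCell_comm F b c i]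
    exact_mod_cast h.numCell_succ_le hc' b j i hi hj
  · exact fun i => by exact_mod_cast h.numCell_swap ha hb i
  · exact fun i => by exact_mod_cast h.numCell_swap hb hc' i
  · intro i hi
    have h1 := h.numAt_eq_sum_numCell hn hb ha hi
    rw [h.numAt_eq_sum_numCell hn hb hc' hi] at h1
    simp only [numCell_comm F b a] at h1
    exact_mod_cast h1.symm
  · exact_mod_cast hab'
  · exact_mod_cast hbc'
  · rw [add_assoc]
    exact_mod_cast hfirst

/-- If at least half of the letters move freely to the front, then two of them are balanced, unless
there are two such letters and words of length four. -/
theorem exists_balanced (h : ForwardClosed F X) (hF : F.Nonempty) (hm : 2 ≤ X.card)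
    (hn : ∀ w ∈ F, w.length ≤ 2 * X.card) (hn' : X.card = 2 → ∀ w ∈ F, w.length ≤ 3) :
    ∃ x ∈ X, ∃ y ∈ X, x ≠ y ∧ F.card ≤ 3 * numBefore F x y ∧ F.card ≤ 3 * numBefore F y x := by
  obtain ⟨m, hm⟩ := Nat.exists_eq_add_of_le' hm
  rw [hm] at hn
  rcases Nat.lt_or_ge m 18 with hlt | hge
  · rcases Nat.lt_or_ge m 3 with hm3 | hm3
    · interval_cases m
      · exact h.exists_balanced_of_certificate hF (hn' hm) hm
          (certificateCheck_two_three.certificate (by norm_num) (by norm_num))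
      · exact h.exists_balanced_three_six hn hm
      · exact h.exists_balanced_of_certificate hF hn hm
          (certificateCheck_four_eight.certificate (by norm_num) (by norm_num))
    · exact h.exists_balanced_of_certificate hF hn hm
        ((certificateCheck_sqrt m hlt hm3).certificate (by norm_num) (by positivity))
  · exact h.exists_balanced_of_certificate hF hn hm (sqrtCertificate m hge)

end ForwardClosed

/-! ### Two letters of each kind -/

/-- The twelve words in `x`, `y`, `z`, `t` which start with `x` or `y`. -/
def wordsFour {α : Type*} (x y z t : α) : List (List α) :=
  [[x, y, z, t], [x, y, t, z], [x, z, y, t], [x, t, y, z], [x, z, t, y], [x, t, z, y],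
   [y, x, z, t], [y, x, t, z], [y, z, x, t], [y, t, x, z], [y, z, t, x], [y, t, z, x]]

theorem mem_wordsFour {α : Type*} {x y z t : α} {w : List α} (hw : w.Nodup)
    (hlen : w.length = 4) (hmem : ∀ e ∈ w, e = x ∨ e = y ∨ e = z ∨ e = t)
    (hhead : ∀ e ∈ w.head?, e = x ∨ e = y) : w ∈ wordsFour x y z t := by
  obtain ⟨p, q, r, s, rfl⟩ : ∃ p q r s, w = [p, q, r, s] := by
    match w, hlen with
    | [p, q, r, s], _ => exact ⟨p, q, r, s, rfl⟩
  simp only [List.head?_cons, Option.mem_def, Option.some.injEq, forall_eq'] at hhead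
  simp only [List.mem_cons, List.not_mem_nil, or_false, forall_eq_or_imp, forall_eq] at hmem
  obtain ⟨-, hq, hr, hs⟩ := hmem
  simp only [List.nodup_cons, List.mem_cons, List.not_mem_nil, or_false, not_or] at hw
  obtain ⟨⟨h1, h2, h3⟩, ⟨h4, h5⟩, h6, -⟩ := hw
  unfold wordsFour
  rcases hhead with rfl | rfl <;>
  rcases hq with rfl | rfl | rfl | rfl <;> first | exact absurd rfl h1 | skip
  all_goals
    rcases hr with rfl | rfl | rfl | rfl <;>
      first | exact absurd rfl h2 | exact absurd rfl h4 | skip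
  all_goals
    rcases hs with rfl | rfl | rfl | rfl <;>
      first | exact absurd rfl h3 | exact absurd rfl h5 | exact absurd rfl h6 | simp

/-- If `x` and `y` move freely to the front and `z` and `t` to the back, and every word starts with
`x` or `y`, then one of the two pairs is balanced: when `x` and `y` are not, the family has eight
words, and `z` comes before `t` in exactly four of them. -/
theorem balanced_or_balanced_of_four {α : Type*} [DecidableEq α] {F : Finset (List α)}
    (hF : F.Nonempty) {x y z t : α} (hd : [x, y, z, t].Nodup)
    (hwords : ∀ w ∈ F, w ∈ wordsFour x y z t)
    (hfront : ∀ u v a b, b = x ∨ b = y → u ++ a :: b :: v ∈ F → u ++ b :: a :: v ∈ F)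
    (hback : ∀ u v a b, a = z ∨ a = t → u ++ a :: b :: v ∈ F → u ++ b :: a :: v ∈ F) :
    (F.card ≤ 3 * numBefore F x y ∧ F.card ≤ 3 * numBefore F y x) ∨
      (F.card ≤ 3 * numBefore F z t ∧ F.card ≤ 3 * numBefore F t z) := by
  simp only [List.nodup_cons, List.mem_cons, List.not_mem_nil, or_false, not_or] at hd
  obtain ⟨⟨hxy, hxz, hxt⟩, ⟨hyz, hyt⟩, hzt, -⟩ := hd
  have hnd : (wordsFour x y z t).Nodup := by
    simp [wordsFour, hxy, hxz, hxt, hyz, hyt, hzt, Ne.symm hxy, Ne.symm hxz, Ne.symm hxt,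
      Ne.symm hyz, Ne.symm hyt, Ne.symm hzt]
  have hcount : ∀ p : List α → Prop, [DecidablePred p] → (F.filter p).card =
      ((wordsFour x y z t).map fun w => if p w then (if w ∈ F then 1 else 0) else 0).sum := by
    intro p _
    rw [← List.sum_toFinset _ hnd, ← Finset.sum_filter, ← Finset.sum_filter, Finset.sum_const,
      smul_eq_mul, mul_one, Finset.filter_filter]
    congr 1
    ext w
    simp only [Finset.mem_filter, List.mem_toFinset]
    exact ⟨fun hw => ⟨hwords w hw.1, hw.2, hw.1⟩, fun hw => ⟨hw.2.2, hw.2.1⟩⟩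
  have hpos := hF.card_pos
  have hcard : F.card = (F.filter fun _ => True).card := by simp
  have hfront' : ∀ u v a b, b = x ∨ b = y →
      (if u ++ a :: b :: v ∈ F then 1 else 0) ≤ (if u ++ b :: a :: v ∈ F then 1 else 0) := by
    intro u v a b hb
    have := hfront u v a b hb
    split_ifs <;> simp_all
  have hback' : ∀ u v a b, a = z ∨ a = t →
      (if u ++ a :: b :: v ∈ F then 1 else 0) ≤ (if u ++ b :: a :: v ∈ F then 1 else 0) := by
    intro u v a b ha
    have := hback u v a b ha
    split_ifs <;> simp_all
  have hle : ∀ w, (if w ∈ F then 1 else 0) ≤ 1 := fun w => by split_ifs <;> simp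
  rw [hcard, hcount] at hpos
  rw [hcard]
  simp only [numBefore, hcount]
  simp only [wordsFour, List.map_cons, List.map_nil, List.sum_cons, List.sum_nil, if_true,
    List.idxOf_cons, beq_self_eq_true, cond_true, cond_false, beq_false_of_ne hxy,
    beq_false_of_ne (Ne.symm hxy), beq_false_of_ne hxz, beq_false_of_ne (Ne.symm hxz),
    beq_false_of_ne hxt, beq_false_of_ne (Ne.symm hxt), beq_false_of_ne hyz, beq_false_of_ne
    (Ne.symm hyz), beq_false_of_ne hyt, beq_false_of_ne (Ne.symm hyt), beq_false_of_ne hzt,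
    beq_false_of_ne (Ne.symm hzt), zero_add, Nat.reduceAdd, Nat.reduceLT, if_false,
    Nat.lt_add_one, Nat.not_lt_zero, zero_lt_one] at hpos ⊢
  have f1 := hfront' [x, z] [] t y (Or.inr rfl)
  have f2 := hfront' [x] [t] z y (Or.inr rfl)
  have f3 := hfront' [x, t] [] z y (Or.inr rfl)
  have f4 := hfront' [x] [z] t y (Or.inr rfl)
  have f5 := hfront' [y, z] [] t x (Or.inl rfl)
  have f6 := hfront' [y] [t] z x (Or.inl rfl)
  have f7 := hfront' [y, t] [] z x (Or.inl rfl)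
  have f8 := hfront' [y] [z] t x (Or.inl rfl)
  have e1 := hfront' [] [z, t] x y (Or.inr rfl)
  have e2 := hfront' [] [z, t] y x (Or.inl rfl)
  have e3 := hback' [x, y] [] z t (Or.inl rfl)
  have e4 := hback' [x, y] [] t z (Or.inr rfl)
  have e5 := hback' [y, x] [] z t (Or.inl rfl)
  have e6 := hback' [y, x] [] t z (Or.inr rfl)
  have e7 := hback' [x] [y] z t (Or.inl rfl)
  have e8 := hback' [x] [y] t z (Or.inr rfl)
  have e9 := hback' [y] [x] z t (Or.inl rfl)
  have e10 := hback' [y] [x] t z (Or.inr rfl)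
  have g1 := hle [x, y, z, t]
  simp only [List.nil_append, List.cons_append] at f1 f2 f3 f4 f5 f6 f7 f8
  simp only [List.nil_append, List.cons_append] at e1 e2 e3 e4 e5 e6 e7 e8 e9 e10
  omega

/-! ### Basic words of an antimatroid -/

namespace Antimatroid

variable {α : Type*} [DecidableEq α] (A : Antimatroid α)

theorem mem_elements {A : Antimatroid α} {e : α} : e ∈ A.elements ↔ ∃ S ∈ A.sets, e ∈ S := by
  simp [elements]

theorem subset_elements {S : Finset α} (hS : S ∈ A.sets) : S ⊆ A.elements :=
  fun _ he => mem_elements.2 ⟨S, hS, he⟩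

/-- Every member is the set of letters of a word all of whose prefixes are members. -/
theorem exists_word : ∀ S ∈ A.sets, ∃ w : List α, w.Nodup ∧ w.toFinset = S ∧
    ∀ u, u <+: w → u.toFinset ∈ A.sets := by
  intro S
  induction hk : S.card generalizing S with
  | zero =>
    intro hS
    obtain rfl := Finset.card_eq_zero.1 hk
    exact ⟨[], by simp, by simp, fun u hu => by simpa [List.prefix_nil.1 hu] using hS⟩
  | succ k ih =>
    intro hS
    obtain ⟨x, hx, hxS⟩ := A.accessible S hS (Finset.card_pos.1 (by omega))
    obtain ⟨w, hw, hwS, hpre⟩ := ih (S.erase x) (by rw [Finset.card_erase_of_mem hx]; omega) hxS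
    have hxw : x ∉ w := fun h => by
      have := List.mem_toFinset.2 h
      simp [hwS] at this
    have hS' : (w ++ [x]).toFinset = S := by
      rw [List.toFinset_append, hwS]
      ext e
      by_cases he : e = x <;> simp [he, hx]
    refine ⟨w ++ [x], ?_, hS', ?_⟩
    · rw [List.nodup_append]
      exact ⟨hw, by simp, fun a ha b hb => by
        rintro rfl
        exact hxw (by simpa [List.mem_singleton.1 hb] using ha)⟩
    · intro u hu
      rcases List.prefix_concat_iff.1 hu with rfl | hu
      · rwa [hS']
      · exact hpre u hu

theorem elements_mem_sets (hne : A.elements.Nonempty) : A.elements ∈ A.sets := by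
  obtain ⟨e, he⟩ := hne
  obtain ⟨S, hS, -⟩ := mem_elements.1 he
  have key : ∀ 𝒮 ⊆ A.sets, S ∪ 𝒮.biUnion id ∈ A.sets := by
    intro 𝒮
    induction 𝒮 using Finset.induction_on with
    | empty => intro _; simpa using hS
    | insert T 𝒮 _ ih =>
      intro h𝒮
      rw [Finset.biUnion_insert, Finset.union_left_comm]
      exact A.union_mem _ (h𝒮 (Finset.mem_insert_self _ _)) _
        (ih fun U hU => h𝒮 (Finset.mem_insert_of_mem hU))
  have := key A.sets subset_rfl
  rwa [← elements, Finset.union_eq_right.2 (A.subset_elements hS)] at this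

theorem basicWords_nonempty (hne : A.elements.Nonempty) : A.basicWords.Nonempty := by
  obtain ⟨w, hw⟩ := A.exists_word _ (A.elements_mem_sets hne)
  exact ⟨w, (A.mem_basicWords w).2 hw⟩

variable {A}

/-- Two consecutive letters of a basic word may be exchanged when the new prefix is a member. -/
theorem exchange_mem_basicWords {u v : List α} {a b : α}
    (h : u ++ a :: b :: v ∈ A.basicWords) (hb : u.toFinset ∪ {b} ∈ A.sets) :
    u ++ b :: a :: v ∈ A.basicWords := by
  rw [mem_basicWords] at h ⊢
  obtain ⟨hnd, hE, hpre⟩ := h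
  have hp : (u ++ b :: a :: v).Perm (u ++ a :: b :: v) := (List.Perm.swap _ _ _).append_left u
  refine ⟨hp.nodup_iff.2 hnd, by rw [List.toFinset_eq_of_perm _ _ hp, hE], ?_⟩
  intro p hpw
  rcases List.prefix_or_prefix_of_prefix hpw (List.prefix_append u _) with hpu | ⟨q, rfl⟩
  · exact hpre p (hpu.trans (List.prefix_append _ _))
  · match q, (List.prefix_append_right_inj u).1 hpw with
    | [], _ => exact hpre _ (by simp)
    | [c], hq =>
      obtain ⟨rfl, -⟩ := List.cons_prefix_cons.1 hq
      simpa using hb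
    | c :: d :: q, hq =>
      obtain ⟨rfl, hq₁⟩ := List.cons_prefix_cons.1 hq
      obtain ⟨rfl, hq₂⟩ := List.cons_prefix_cons.1 hq₁
      have := hpre (u ++ d :: c :: q) ((List.prefix_append_right_inj u).2
        (List.cons_prefix_cons.2 ⟨rfl, List.cons_prefix_cons.2 ⟨rfl, hq₂⟩⟩))
      rwa [List.toFinset_eq_of_perm _ _ ((List.Perm.swap c d q).append_left u)] at this

theorem exchange_of_singleton_mem {u v : List α} {a b : α} (hb : {b} ∈ A.sets)
    (h : u ++ a :: b :: v ∈ A.basicWords) : u ++ b :: a :: v ∈ A.basicWords :=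
  exchange_mem_basicWords h (A.union_mem _
    (((A.mem_basicWords _).1 h).2.2 u (List.prefix_append _ _)) _ hb)

/-- A minimal member that contains `z` is a path with endpoint `z`. -/
theorem exists_isPath {Q : Finset α} (hQ : Q ∈ A.sets) {z : α} (hz : z ∈ Q) :
    ∃ P ⊆ Q, z ∈ P ∧ A.IsPath P ∧ P.erase z ∈ A.sets := by
  have hfin : (A.sets.filter fun P => P ⊆ Q ∧ z ∈ P).Nonempty :=
    ⟨Q, Finset.mem_filter.2 ⟨hQ, subset_rfl, hz⟩⟩
  obtain ⟨P, hP, hmin⟩ := Finset.exists_min_image _ Finset.card hfin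
  obtain ⟨hPA, hPQ, hzP⟩ := Finset.mem_filter.1 hP
  have huniq : ∀ x, x ∈ P ∧ P.erase x ∈ A.sets → x = z := by
    rintro x ⟨hx, hxA⟩
    by_contra hne
    have := hmin (P.erase x) (Finset.mem_filter.2 ⟨hxA, (Finset.erase_subset _ _).trans hPQ,
      Finset.mem_erase.2 ⟨Ne.symm hne, hzP⟩⟩)
    exact absurd (Finset.card_erase_lt_of_mem hx) (not_lt.2 this)
  obtain ⟨x, hx⟩ := A.accessible P hPA ⟨z, hzP⟩
  obtain rfl := huniq x hx
  exact ⟨P, hPQ, hzP, ⟨hPA, x, hx, huniq⟩, hx.2⟩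

theorem not_ssubset_of_height_le_two (hh : A.height ≤ 2) {P₁ P₂ P₃ : Finset α}
    (h₁ : A.IsPath P₁) (h₂ : A.IsPath P₂) (h₃ : A.IsPath P₃) (h₁₂ : P₁ ⊂ P₂) : ¬P₂ ⊂ P₃ := by
  intro h₂₃
  have hle : ({P₁, P₂, P₃} : Set (Finset α)).encard ≤ 2 := by
    refine (Set.encard_le_chainHeight_of_isChain {P : Finset α | A.IsPath P} _ ?_ ?_).trans hh
    · rintro P (rfl | rfl | rfl) <;> assumption
    · rintro P (rfl | rfl | rfl) P' (rfl | rfl | rfl) hne <;>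
        first
        | exact absurd rfl hne
        | exact Or.inl h₁₂.subset
        | exact Or.inl h₂₃.subset
        | exact Or.inl (h₁₂.trans h₂₃).subset
        | exact Or.inr h₁₂.subset
        | exact Or.inr h₂₃.subset
        | exact Or.inr (h₁₂.trans h₂₃).subset
  have h3 : ({P₁, P₂, P₃} : Finset (Finset α)).card = 3 :=
    Finset.card_eq_three.2 ⟨P₁, P₂, P₃, h₁₂.ne, (h₁₂.trans h₂₃).ne, h₂₃.ne, rfl⟩
  have : ({P₁, P₂, P₃} : Set (Finset α)).encard = 3 := by
    have := Set.encard_coe_eq_coe_finsetCard ({P₁, P₂, P₃} : Finset (Finset α))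
    rw [h3] at this
    simpa using this
  rw [this] at hle
  exact absurd hle (by decide)

/-- In height at most two, a letter that is not a member on its own is the endpoint of a maximal
path, so it is never needed for another letter and may be moved towards the back. -/
theorem exchange_of_singleton_not_mem (hh : A.height ≤ 2) {u v : List α} {a b : α}
    (ha : {a} ∉ A.sets) (h : u ++ a :: b :: v ∈ A.basicWords) :
    u ++ b :: a :: v ∈ A.basicWords := by
  obtain ⟨hnd, -, hpre⟩ := (A.mem_basicWords _).1 h
  have hu : u.toFinset ∈ A.sets := hpre u (List.prefix_append _ _)
  have hQ : (u ++ [a, b]).toFinset ∈ A.sets :=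
    hpre _ ((List.prefix_append_right_inj u).2 ⟨v, rfl⟩)
  have hab : a ≠ b := by
    rintro rfl
    simp [List.nodup_append] at hnd
  obtain ⟨P, hPQ, hbP, hP, hPb⟩ := exists_isPath hQ (z := b) (by simp)
  apply exchange_mem_basicWords h
  by_cases haP : a ∈ P
  · exfalso
    obtain ⟨P', hP'P, haP', hP', hPa'⟩ := exists_isPath hPb (Finset.mem_erase.2 ⟨hab, haP⟩)
    obtain ⟨q, hq⟩ : (P'.erase a).Nonempty := by
      rw [Finset.nonempty_iff_ne_empty]
      intro he
      rcases (Finset.erase_eq_empty_iff _ _).1 he with rfl | rfl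
      · simp at haP'
      · exact ha hP'.1
    obtain ⟨P'', hP''P, -, hP'', -⟩ := exists_isPath hPa' hq
    exact not_ssubset_of_height_le_two hh hP'' hP' hP
      (hP''P.trans_ssubset (Finset.erase_ssubset haP'))
      (hP'P.trans_ssubset (Finset.erase_ssubset hbP))
  · have : u.toFinset ∪ {b} = u.toFinset ∪ P := by
      ext e
      have he := @hPQ e
      simp only [List.mem_toFinset, List.mem_append, List.mem_cons, List.not_mem_nil,
        or_false] at he
      simp only [Finset.mem_union, List.mem_toFinset, Finset.mem_singleton]
      constructor
      · rintro (heu | rfl)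
        · exact Or.inl heu
        · exact Or.inr hbP
      · rintro (heu | heP)
        · exact Or.inl heu
        · rcases he heP with heu | rfl | heb
          · exact Or.inl heu
          · exact absurd heP haP
          · exact Or.inr heb
    rw [this]
    exact A.union_mem _ hu _ hP.1

end Antimatroid

namespace ForwardClosed

variable {α : Type*} [DecidableEq α] {F : Finset (List α)} {X : Finset α}

theorem of_append (hnd : ∀ w ∈ F, w.Nodup) (hmem : ∀ w ∈ F, ∀ x ∈ X, x ∈ w)
    (hex : ∀ u v a b, b ∈ X → u ++ a :: b :: v ∈ F → u ++ b :: a :: v ∈ F) :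
    ForwardClosed F X where
  nodup := hnd
  mem := hmem
  exchange w hw x hx i hi := by
    have hlt : i + 1 < w.length := hi ▸ List.idxOf_lt_length_iff.2 (hmem w hw x hx)
    have hx' : w[i + 1] = x := by simp only [← hi, List.getElem_idxOf]
    obtain ⟨u, a, b, v, rfl, rfl⟩ := List.exists_eq_append_of_succ_lt_length hlt
    rw [List.exchangeAt_append]
    obtain rfl : b = x := by simpa using hx'
    exact hex u v a b hx hw

end ForwardClosed

theorem List.idxOf_reverse_lt_iff {α : Type*} [DecidableEq α] {w : List α} (hw : w.Nodup)
    {x y : α} (hx : x ∈ w) (hy : y ∈ w) :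
    w.reverse.idxOf x < w.reverse.idxOf y ↔ w.idxOf y < w.idxOf x := by
  have key : ∀ z ∈ w, w.reverse.idxOf z = w.length - 1 - w.idxOf z := by
    intro z hz
    have hlt := List.idxOf_lt_length_iff.2 hz
    have hlt' : w.length - 1 - w.idxOf z < w.reverse.length := by
      rw [List.length_reverse]; omega
    have hz' : w.reverse[w.length - 1 - w.idxOf z] = z := by
      rw [List.getElem_reverse]
      have : w.length - 1 - (w.length - 1 - w.idxOf z) = w.idxOf z := by omega
      simp only [this, List.getElem_idxOf]
    conv_lhs => rw [← hz']
    exact (List.nodup_reverse.2 hw).idxOf_getElem _ _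
  have h1 := List.idxOf_lt_length_iff.2 hx
  have h2 := List.idxOf_lt_length_iff.2 hy
  rw [key x hx, key y hy]
  omega

/-! ### Balanced pairs in antimatroids of height at most two -/

namespace Antimatroid

variable {α : Type*} [DecidableEq α] {A : Antimatroid α}

theorem singleton_mem_of_cons_mem_basicWords {a : α} {v : List α}
    (h : a :: v ∈ A.basicWords) : {a} ∈ A.sets := by
  simpa using ((A.mem_basicWords _).1 h).2.2 [a] ⟨v, rfl⟩

theorem length_of_mem_basicWords {w : List α} (h : w ∈ A.basicWords) :
    w.length = A.elements.card := by
  obtain ⟨hnd, hE, -⟩ := (A.mem_basicWords w).1 h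
  rw [← hE, List.toFinset_card_of_nodup hnd]

theorem mem_iff_of_mem_basicWords {w : List α} (h : w ∈ A.basicWords) {e : α} :
    e ∈ w ↔ e ∈ A.elements := by
  rw [← ((A.mem_basicWords w).1 h).2.1, List.mem_toFinset]

theorem forwardClosed_basicWords {X : Finset α} (hX : X ⊆ A.elements)
    (hs : ∀ x ∈ X, {x} ∈ A.sets) : ForwardClosed A.basicWords X :=
  ForwardClosed.of_append (fun w hw => ((A.mem_basicWords w).1 hw).1)
    (fun _ hw _ hx => (mem_iff_of_mem_basicWords hw).2 (hX hx))
    fun _ _ _ b hb => exchange_of_singleton_mem (hs b hb)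

theorem forwardClosed_reverse_basicWords (hh : A.height ≤ 2) {X : Finset α}
    (hX : X ⊆ A.elements) (hs : ∀ x ∈ X, {x} ∉ A.sets) :
    ForwardClosed (A.basicWords.image List.reverse) X := by
  apply ForwardClosed.of_append
  · intro w hw
    obtain ⟨r, hr, rfl⟩ := Finset.mem_image.1 hw
    exact List.nodup_reverse.2 ((A.mem_basicWords r).1 hr).1
  · intro w hw x hx
    obtain ⟨r, hr, rfl⟩ := Finset.mem_image.1 hw
    exact List.mem_reverse.2 ((mem_iff_of_mem_basicWords hr).2 (hX hx))
  · intro u v a b hb hw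
    obtain ⟨r, hr, hr'⟩ := Finset.mem_image.1 hw
    obtain rfl : r = v.reverse ++ b :: a :: u.reverse := by
      rw [← List.reverse_reverse r, hr']; simp
    exact Finset.mem_image.2 ⟨_, exchange_of_singleton_not_mem hh (hs b hb) hr, by simp⟩

theorem card_image_reverse (F : Finset (List α)) : (F.image List.reverse).card = F.card :=
  Finset.card_image_of_injective _ List.reverse_injective

theorem numBefore_image_reverse {x y : α} (hx : x ∈ A.elements) (hy : y ∈ A.elements) :
    numBefore (A.basicWords.image List.reverse) x y = numBefore A.basicWords y x := by
  rw [numBefore, Finset.filter_image, card_image_reverse, numBefore]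
  congr 1
  apply Finset.filter_congr
  intro w hw
  exact List.idxOf_reverse_lt_iff ((A.mem_basicWords w).1 hw).1
    ((mem_iff_of_mem_basicWords hw).2 hx) ((mem_iff_of_mem_basicWords hw).2 hy)

theorem isBalancedPair_of_card_le (hne : A.elements.Nonempty) {x y : α} (hx : x ∈ A.elements)
    (hy : y ∈ A.elements) (hxy : A.basicWords.card ≤ 3 * numBefore A.basicWords x y)
    (hyx : A.basicWords.card ≤ 3 * numBefore A.basicWords y x) : A.IsBalancedPair x y := by
  have hpos : (0 : ℚ) < A.basicWords.card := by
    exact_mod_cast (A.basicWords_nonempty hne).card_pos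
  refine ⟨hx, hy, le_min ?_ ?_⟩
  · have : (A.basicWords.card : ℚ) ≤ 3 * numBefore A.basicWords x y := by exact_mod_cast hxy
    change (1 / 3 : ℚ) ≤ (numBefore A.basicWords x y : ℚ) / A.basicWords.card
    rw [le_div_iff₀ hpos]; linarith
  · have : (A.basicWords.card : ℚ) ≤ 3 * numBefore A.basicWords y x := by exact_mod_cast hyx
    change (1 / 3 : ℚ) ≤ (numBefore A.basicWords y x : ℚ) / A.basicWords.card
    rw [le_div_iff₀ hpos]; linarith

/-- Two letters that are members on their own and two that are not. -/
theorem exists_isBalancedPair_of_four (hne : A.elements.Nonempty) (hh : A.height ≤ 2)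
    {x y z t : α} (hd : [x, y, z, t].Nodup) (hE : A.elements = {x, y, z, t})
    (hx : {x} ∈ A.sets) (hy : {y} ∈ A.sets) (hz : {z} ∉ A.sets) (ht : {t} ∉ A.sets) :
    ∃ a b : α, A.IsBalancedPair a b := by
  have hcard : A.elements.card = 4 := by
    rw [hE]; simpa using List.toFinset_card_of_nodup hd
  have hwords : ∀ w ∈ A.basicWords, w ∈ wordsFour x y z t := by
    intro w hw
    have hmem : ∀ e ∈ w, e = x ∨ e = y ∨ e = z ∨ e = t := by
      intro e he
      have := (mem_iff_of_mem_basicWords hw).1 he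
      simpa [hE] using this
    apply mem_wordsFour ((A.mem_basicWords w).1 hw).1
      ((length_of_mem_basicWords hw).trans hcard) hmem
    intro e he
    obtain ⟨v, rfl⟩ := List.head?_eq_some_iff.1 he
    have hes := singleton_mem_of_cons_mem_basicWords hw
    rcases hmem e (by simp) with rfl | rfl | rfl | rfl
    · exact Or.inl rfl
    · exact Or.inr rfl
    · exact absurd hes hz
    · exact absurd hes ht
  have hxE : x ∈ A.elements := by simp [hE]
  have hyE : y ∈ A.elements := by simp [hE]
  have hzE : z ∈ A.elements := by simp [hE]
  have htE : t ∈ A.elements := by simp [hE]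
  rcases balanced_or_balanced_of_four (A.basicWords_nonempty hne) hd hwords
    (by
      rintro u v a b (rfl | rfl)
      · exact exchange_of_singleton_mem hx
      · exact exchange_of_singleton_mem hy)
    (by
      rintro u v a b (rfl | rfl)
      · exact exchange_of_singleton_not_mem hh hz
      · exact exchange_of_singleton_not_mem hh ht) with ⟨h1, h2⟩ | ⟨h1, h2⟩
  · exact ⟨x, y, isBalancedPair_of_card_le hne hxE hyE h1 h2⟩
  · exact ⟨z, t, isBalancedPair_of_card_le hne hzE htE h1 h2⟩

/-- An antimatroid with at most two elements, only one of which is a member on its own, has a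
single basic word. -/
theorem isChainAntimatroid_of_card_le_two (hne : A.elements.Nonempty)
    (hn : A.elements.card ≤ 2) {s : α} (hs : ∀ e ∈ A.elements, {e} ∈ A.sets → e = s) :
    A.IsChainAntimatroid := by
  obtain ⟨w, hw⟩ := A.basicWords_nonempty hne
  refine ⟨w, hw, fun w' hw' => ?_⟩
  -- Both words start with `s`, and at most one letter remains.
  have hcons : ∀ r ∈ A.basicWords, ∃ l : List α, r = s :: l ∧ l.length ≤ 1 ∧
      ∀ e, e ∈ l ↔ e ∈ A.elements ∧ e ≠ s := by
    intro r hr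
    have hlen := length_of_mem_basicWords hr
    have hnd := ((A.mem_basicWords r).1 hr).1
    match r with
    | [] => exact absurd hlen.symm hne.card_pos.ne'
    | a :: l =>
      obtain rfl := hs a ((mem_iff_of_mem_basicWords hr).1 (by simp))
        (singleton_mem_of_cons_mem_basicWords hr)
      rw [List.length_cons] at hlen
      have hal := (List.nodup_cons.1 hnd).1
      refine ⟨l, rfl, by omega, fun e => ?_⟩
      rw [← mem_iff_of_mem_basicWords hr, List.mem_cons]
      constructor
      · exact fun he => ⟨Or.inr he, fun h => hal (h ▸ he)⟩
      · exact fun he => he.1.resolve_left he.2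
  obtain ⟨l, rfl, hl, hle⟩ := hcons w hw
  obtain ⟨l', rfl, hl', hle'⟩ := hcons w' hw'
  congr 1
  match l, l', hl, hl' with
  | [], [], _, _ => rfl
  | [a], [], _, _ => exact absurd ((hle' a).2 ((hle a).1 (by simp))) (by simp)
  | [], [a], _, _ => exact absurd ((hle a).2 ((hle' a).1 (by simp))) (by simp)
  | [a], [b], _, _ => simpa using (hle b).2 ((hle' b).1 (by simp))

end Antimatroid

theorem mainTheorem2 {α : Type*} [DecidableEq α] (A : Antimatroid α)
    (hne : A.elements.Nonempty) (hheight : A.height ≤ 2) :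
    ((A.elements.card = 1 ∨ A.elements.card = 2) ∧ A.IsChainAntimatroid) ∨
      ∃ x y : α, A.IsBalancedPair x y := by
  set S := A.elements.filter fun e => {e} ∈ A.sets with hS
  set T := A.elements.filter fun e => {e} ∉ A.sets with hT
  have hcard : S.card + T.card = A.elements.card :=
    Finset.card_filter_add_card_filter_not _
  have hSE : S ⊆ A.elements := Finset.filter_subset _ _
  have hTE : T ⊆ A.elements := Finset.filter_subset _ _
  have hSs : ∀ x ∈ S, {x} ∈ A.sets := fun x hx => (Finset.mem_filter.1 hx).2
  have hTs : ∀ x ∈ T, {x} ∉ A.sets := fun x hx => (Finset.mem_filter.1 hx).2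
  have hlen : ∀ w ∈ A.basicWords, w.length = A.elements.card :=
    fun w hw => Antimatroid.length_of_mem_basicWords hw
  have hpos : 0 < S.card := by
    obtain ⟨w, hw⟩ := A.basicWords_nonempty hne
    match w, hw with
    | [], hw => exact absurd (hlen _ hw).symm hne.card_pos.ne'
    | a :: v, hw =>
      exact Finset.card_pos.2 ⟨a, Finset.mem_filter.2
        ⟨(Antimatroid.mem_iff_of_mem_basicWords hw).1 (by simp),
          Antimatroid.singleton_mem_of_cons_mem_basicWords hw⟩⟩
  rcases Nat.lt_or_ge S.card T.card with hlt | hge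
  · -- The elements of `T` move freely to the back, that is, to the front of the reversed words.
    right
    have hlen' : ∀ w ∈ A.basicWords.image List.reverse, w.length = A.elements.card := by
      intro w hw
      obtain ⟨r, hr, rfl⟩ := Finset.mem_image.1 hw
      rw [List.length_reverse, hlen r hr]
    obtain ⟨x, hx, y, hy, -, h1, h2⟩ :=
      (Antimatroid.forwardClosed_reverse_basicWords hheight hTE hTs).exists_balanced
        ((A.basicWords_nonempty hne).image _) (by omega)
        (fun w hw => by rw [hlen' w hw]; omega) (fun h w hw => by rw [hlen' w hw]; omega)
    rw [Antimatroid.card_image_reverse,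
      Antimatroid.numBefore_image_reverse (hTE hx) (hTE hy)] at h1
    rw [Antimatroid.card_image_reverse,
      Antimatroid.numBefore_image_reverse (hTE hy) (hTE hx)] at h2
    exact ⟨x, y, Antimatroid.isBalancedPair_of_card_le hne (hTE hx) (hTE hy) h2 h1⟩
  · rcases Nat.lt_or_ge S.card 2 with h1 | h2
    · left
      obtain ⟨s, hs⟩ := Finset.card_eq_one.1 (by omega : S.card = 1)
      refine ⟨by omega, Antimatroid.isChainAntimatroid_of_card_le_two hne (by omega) (s := s) ?_⟩
      intro e he hes
      exact Finset.mem_singleton.1 (hs ▸ Finset.mem_filter.2 ⟨he, hes⟩)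
    · right
      by_cases h22 : S.card = 2 ∧ T.card = 2
      · obtain ⟨x, y, hxy, hSxy⟩ := Finset.card_eq_two.1 h22.1
        obtain ⟨z, t, hzt, hTzt⟩ := Finset.card_eq_two.1 h22.2
        have hx : x ∈ S := by simp [hSxy]
        have hy : y ∈ S := by simp [hSxy]
        have hz : z ∈ T := by simp [hTzt]
        have ht : t ∈ T := by simp [hTzt]
        have hST : ∀ a ∈ S, ∀ b ∈ T, a ≠ b := fun a ha b hb hab =>
          hTs b hb (hab ▸ hSs a ha)
        refine Antimatroid.exists_isBalancedPair_of_four hne hheight (x := x) (y := y) (z := z)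
          (t := t) ?_ ?_ (hSs x hx) (hSs y hy) (hTs z hz) (hTs t ht)
        · simp [hxy, hzt, hST x hx z hz, hST x hx t ht, hST y hy z hz, hST y hy t ht]
        · rw [← Finset.filter_union_filter_not_eq (fun e => {e} ∈ A.sets) A.elements, ← hS, ← hT,
            hSxy, hTzt]
          ext e
          simp only [Finset.mem_union, Finset.mem_insert, Finset.mem_singleton, or_assoc]
      · obtain ⟨x, hx, y, hy, -, h1, h2⟩ :=
          (Antimatroid.forwardClosed_basicWords hSE hSs).exists_balanced
            (A.basicWords_nonempty hne) h2
            (fun w hw => by rw [hlen w hw]; omega) (fun h w hw => by rw [hlen w hw]; omega)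
        exact ⟨x, y, Antimatroid.isBalancedPair_of_card_le hne (hSE hx) (hSE hy) h1 h2⟩
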